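/- All logarithms are in base $2$. Let $f_Z$ be a probability density on $\mathbb{R}$ that is unimodal (nondecreasing up to some point, nonincreasing from that point on) and symmetric about some point, and let $Z\sim f_Z$ have finite variance. Put $\bar Z=\max f_Z$ and, for $x\in(0,\bar Z)$, $b^-(x)=\inf\{u: f_Z(u)\ge x\}$ and $b^+(x)=\sup\{u: f_Z(u)\ge x\}$. Let $W_Z$ and $D_Z$ be random variables on $(0,\bar Z)$ with densities $f_W(x)=b^+(x)-b^-(\bar Z-x)$ and $f_D(x)=b^+(x)-b^-(x)$. The shifted layered quantizer uses the shared randomness $S=(U,W_Z)$, with $U$ uniform on $(0,1)$ and independent of $W_Z$; it encodes an input $X$, independent of $S$, as $M=\lfloor X/f_W(W_Z)+U+\tfrac12\rfloor$, and it decodes $M$ as $(M-U)f_W(W_Z)+\tfrac12\bigl(b^+(W_Z)+b^-(\bar Z-W_Z)\bigr)$. Write $\mathcal{H}(M|S)$ for the conditional entropy and $h$ for differential entropy. Let $t>0$, $a\in\mathbb{R}$, and let $X$ be supported in the interval $[a,a+t]$. Then $h(W_Z)$ and $h(D_Z)$ are finite, and $$\mathcal{H}(M|S)\le \log t+\frac{8\log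 e}{t}\sqrt{\mathrm{Var}[Z]}+h(W_Z).$$ Let moreover $\mathcal{H}^*$ be the infimum of $\mathcal{H}(M'|S')$ for an input $X'$ uniform on $(a,a+t)$ over all quantization schemes with shared randomness $S'$ independent of $X'$, descriptions $M'=\mathscr{E}(X',S')$ in a countable set and decoder $\mathscr{D}$, for which the error $\mathscr{D}(\mathscr{E}(x,S'),S')-x$ has density $f_Z$ for every $x\in[a,a+t]$. Then $$\mathcal{H}(M|S)-\mathcal{H}^*\le\frac{8\log e}{t}\sqrt{\mathrm{Var}[Z]}+2 ,$$ and likewise $\mathcal{H}(M|S)-\bigl(\log t+h(D_Z)\bigr)\le\frac{8\log e}{t}\sqrt{\mathrm{Var}[Z]}+2$. In particular this holds for $X$ uniform on $(a,a+t)$. -/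

import Mathlib

open MeasureTheory ProbabilityTheory Set
open scoped ENNReal

universe u v

noncomputable section

namespace LayeredQuantizer

/-! ### Entropies, in bits -/

/-- Entropy `-∑ p(m) log₂ p(m)` of a probability measure on a countable set, as an element of
`[0, ∞]` (every term is nonnegative). -/
def discreteEntropy {α : Type v} [MeasurableSpace α] (p : Measure α) : ℝ≥0∞ :=
  ∑' m : α, ENNReal.ofReal (-(p.real {m} * Real.logb 2 (p.real {m})))

/-- Differential entropy `-∫ g log₂ g` of a density `g` on the real line. -/
def diffEntropy (g : ℝ → ℝ) : ℝ := -∫ x, g x * Real.logb 2 (g x)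

/-- The integral that defines `diffEntropy g` converges absolutely. -/
def HasDiffEntropy (g : ℝ → ℝ) : Prop := Integrable (fun x => g x * Real.logb 2 (g x)) volume

/-! ### Noise densities -/

/-- `f` is a probability density function on the real line. -/
structure IsDensity (f : ℝ → ℝ) : Prop where
  measurable : Measurable f
  nonneg : ∀ x, 0 ≤ f x
  lintegral_eq_one : ∫⁻ x, ENNReal.ofReal (f x) = 1

/-- The measure on the real line with density `f`. -/
def lawOf (f : ℝ → ℝ) : Measure ℝ := volume.withDensity fun x => ENNReal.ofReal (f x)

/-- `f` is nondecreasing up to some point and nonincreasing from that point on. -/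
def IsUnimodal (f : ℝ → ℝ) : Prop := ∃ m : ℝ, MonotoneOn f (Iic m) ∧ AntitoneOn f (Ici m)

/-- `f` is symmetric about some point. -/
def IsSymmetric (f : ℝ → ℝ) : Prop := ∃ c : ℝ, ∀ x, f (c + x) = f (c - x)

/-- Superlevel set of `f` at height `x`. -/
def superlevel (f : ℝ → ℝ) (x : ℝ) : Set ℝ := {z | x ≤ f z}

/-- The maximum of `f` (for a unimodal `f` the supremum is attained at a mode). -/
def peak (f : ℝ → ℝ) : ℝ := ⨆ x, f x

/-- Left end of the superlevel set. -/
def bMinus (f : ℝ → ℝ) (x : ℝ) : ℝ := sInf (superlevel f x)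

/-- Right end of the superlevel set. -/
def bPlus (f : ℝ → ℝ) (x : ℝ) : ℝ := sSup (superlevel f x)

/-- Density `f_D` of the layer height of the direct layered quantizer. -/
def directDensity (f : ℝ → ℝ) : ℝ → ℝ :=
  (Ioo 0 (peak f)).indicator fun x => bPlus f x - bMinus f x

/-- Density `f_W` of the layer height of the shifted layered quantizer. -/
def shiftedDensity (f : ℝ → ℝ) : ℝ → ℝ :=
  (Ioo 0 (peak f)).indicator fun x => bPlus f x - bMinus f (peak f - x)

/-! ### Point-to-point quantization schemes with shared randomness -/

/-- A scheme with shared randomness `S` in `σ` and descriptions in `α`: the law of `S`, the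
encoder `M = enc x S` and the decoder `Y = dec M S`. -/
structure Scheme (σ : Type u) (α : Type v) [MeasurableSpace σ] where
  law : Measure σ
  enc : ℝ → σ → α
  dec : α → σ → ℝ

/-- The scheme is an additive independent noise quantizer on the input set `I` with error law `ν`:
its ingredients are genuine (a probability law, measurable maps), and for every input `x ∈ I` the
error `Y - x` has law `ν`. -/
structure Scheme.IsAINQ {σ : Type u} {α : Type v} [MeasurableSpace σ] [MeasurableSpace α]
    (Q : Scheme σ α) (I : Set ℝ) (ν : Measure ℝ) : Prop where
  isProbabilityMeasure_law : IsProbabilityMeasure Q.law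
  measurable_enc : Measurable fun p : ℝ × σ => Q.enc p.1 p.2
  measurable_dec : Measurable fun p : α × σ => Q.dec p.1 p.2
  map_error : ∀ x ∈ I, Q.law.map (fun s => Q.dec (Q.enc x s) s - x) = ν

/-- The conditional entropy `H(M | S)` in bits when the input `X` has law `μ` and is independent of
the shared randomness `S`: the conditional law of `M` given `S = s` is then the law of `enc X s`, and
its entropy is averaged over the law of `S`. -/
def Scheme.condEntropy {σ : Type u} {α : Type v} [MeasurableSpace σ] [MeasurableSpace α]
    (Q : Scheme σ α) (μ : Measure ℝ) : ℝ≥0∞ :=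
  ∫⁻ s, discreteEntropy (μ.map fun x => Q.enc x s) ∂Q.law

/-- The shifted layered quantizer of the noise density `f`. The shared randomness is
`s = (U, W)` with `U` uniform on `(0, 1)` and `W` of density `f_W`, independent of each other; the
input is rounded by `⌊y + 1/2⌋`. -/
def shiftedLayered (f : ℝ → ℝ) : Scheme (ℝ × ℝ) ℤ where
  law := (volume.restrict (Ioo (0 : ℝ) 1)).prod (lawOf (shiftedDensity f))
  enc x s := ⌊x / shiftedDensity f s.2 + s.1 + 1 / 2⌋
  dec m s := ((m : ℝ) - s.1) * shiftedDensity f s.2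
    + (bPlus f s.2 + bMinus f (peak f - s.2)) / 2

/-- The uniform distribution on `(a, b)`. -/
def uniformLaw (a b : ℝ) : Measure ℝ := ProbabilityTheory.cond volume (Ioo a b)

/-- The optimal conditional entropy for the error law `ν` and the input interval `[a, a + t]`: the
infimum of `H(M | S)` for the uniform input on that interval, over all schemes with countably many
descriptions whose error has law `ν` for every input in the interval. -/
def optimalCondEntropy (ν : Measure ℝ) (a t : ℝ) : ℝ≥0∞ :=
  ⨅ (σ : Type u) (_ : MeasurableSpace σ) (α : Type v) (_ : MeasurableSpace α)
    (_ : MeasurableSingletonClass α) (_ : Countable α) (Q : Scheme σ α)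
    (_ : Q.IsAINQ (Icc a (a + t)) ν), Q.condEntropy (uniformLaw a (a + t))

end LayeredQuantizer

end

/-!
# Entropy of the shifted layered quantizer

A symmetric unimodal density `f` is nonincreasing in the distance to its centre `c`, so each of its
superlevel sets is an interval about `c`. Writing `g = f_D` for the length of the layer at height
`x` and `p` for the peak, the layer height of the shifted quantizer has density
`f_W(x) = (g x + g (p - x)) / 2`. A layer-cake formula (`IsSymmUnimodalAt.layer_cake`) turns
`∫ f(z) ρ(|z - c|) dz` into an integral over layers; three choices of `ρ` are needed:

* `ρ = 1` shows that `f_D` and `f_W` integrate to one;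
* `ρ(v) = v` gives `∫ f_D² = 4 E|Z - c| ≤ 4 √Var[Z]`, and `∫ f_W² ≤ ∫ f_D²` by convexity;
* `ρ(v) = log₂ (2 v) + log₂ e`, the derivative of `L log₂ L` at `L = 2 v` (`entropyTilt`), gives
  `h(D_Z) = -E[ρ(|Z - c|)]`, and in particular that this entropy is finite.

*Upper bound.* Given the shared randomness `(u, w)` with step `Δ = f_W(w)`, the description takes at
most `N` values, where `N` averages to `1 + t / Δ` over the dither `u`. Bounding `log₂ N` by its
tangent at that mean and using `log (1 + Δ / t) ≤ Δ / t` gives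
`H(M | S) ≤ log t + h(W_Z) + (log e / t) ∫ f_W²`.

*Lower bound.* For fixed shared randomness a quantizer cuts the interval into cells, and on a cell
`B` with reconstruction point `y` the bathtub principle gives
`∫_B ρ(|y - x - c|) dx ≥ |B| log₂ |B|`. Summing over the cells bounds the entropy below by `log t`
minus the mean of `ρ(|error - c|)`. Since the error has density `f` for every input, averaging over
the shared randomness and the input yields `log t + h(D_Z)` for every scheme.

*Gap.* `f_W` is the average of `f_D` and its reflection, so `h(W_Z) ≤ h(D_Z) + 1`.
-/

noncomputable section

namespace LayeredQuantizer

/-! ### Geometry of the layers of a symmetric unimodal density -/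

lemma setIntegral_ball_eq (ρ : ℝ → ℝ) (c : ℝ) {r : ℝ} (hr : 0 ≤ r) :
    ∫ z in {z | |z - c| < r}, ρ |z - c| = 2 * ∫ v in (0 : ℝ)..r, ρ v := by
  have hmeas : MeasurableSet {z : ℝ | |z - c| < r} :=
    measurableSet_lt (by fun_prop) measurable_const
  rw [← integral_indicator hmeas]
  have e : ({z : ℝ | |z - c| < r}.indicator fun z => ρ |z - c|)
      = fun z => (fun u => (Iio r).indicator ρ |u|) (z - c) := by
    ext z; simp [indicator]
  rw [e, integral_sub_right_eq_self (fun u => (Iio r).indicator ρ |u|), integral_comp_abs,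
    intervalIntegral.integral_of_le hr, integral_Ioc_eq_integral_Ioo,
    setIntegral_indicator measurableSet_Iio]
  rfl

/-- `f` is symmetric about `c` and nonincreasing to the right of `c`. -/
structure IsSymmUnimodalAt (f : ℝ → ℝ) (c : ℝ) : Prop where
  symm : ∀ x, f (c + x) = f (c - x)
  anti : AntitoneOn f (Ici c)

/-- The centre of symmetry of a symmetric unimodal function is a mode. -/
lemma IsUnimodal.exists_isSymmUnimodalAt {f : ℝ → ℝ} (hu : IsUnimodal f) (hs : IsSymmetric f) :
    ∃ c, IsSymmUnimodalAt f c := by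
  obtain ⟨c, hc⟩ := hs
  obtain ⟨m, hmono, hanti⟩ := hu
  refine ⟨c, hc, ?_⟩
  rcases le_total m c with hm | hm
  · exact hanti.mono (Ici_subset_Ici.2 hm)
  · intro x hx y hy hxy
    have hx' : c ≤ x := hx
    have e1 : f x = f (2 * c - x) := by
      have := hc (x - c)
      ring_nf at this ⊢
      exact this
    have e2 : f y = f (2 * c - y) := by
      have := hc (y - c)
      ring_nf at this ⊢
      exact this
    rw [e1, e2]
    exact hmono (by simp only [mem_Iic]; linarith) (by simp only [mem_Iic]; linarith) (by linarith)

namespace IsSymmUnimodalAt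

variable {f : ℝ → ℝ} {c : ℝ}

lemma eq_abs (h : IsSymmUnimodalAt f c) (z : ℝ) : f z = f (c + |z - c|) := by
  rcases abs_cases (z - c) with ⟨e, _⟩ | ⟨e, _⟩
  · rw [e]; ring_nf
  · rw [e, h.symm]; ring_nf

lemma le_of_abs_le (h : IsSymmUnimodalAt f c) {y z : ℝ} (hyz : |y - c| ≤ |z - c|) :
    f z ≤ f y := by
  rw [h.eq_abs y, h.eq_abs z]
  exact h.anti (by simp [abs_nonneg]) (by simp [abs_nonneg]) (by linarith)

lemma le_center (h : IsSymmUnimodalAt f c) (z : ℝ) : f z ≤ f c :=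
  h.le_of_abs_le (by simp)

lemma peak_eq (h : IsSymmUnimodalAt f c) : peak f = f c :=
  le_antisymm (ciSup_le h.le_center) (le_ciSup ⟨f c, by rintro _ ⟨z, rfl⟩; exact h.le_center z⟩ c)

lemma le_peak (h : IsSymmUnimodalAt f c) (z : ℝ) : f z ≤ peak f :=
  h.peak_eq ▸ h.le_center z

/-- By Markov's inequality, the superlevel set of height `x` lies within `1 / x` of the centre. -/
lemma abs_le_of_mem_superlevel (h : IsSymmUnimodalAt f c) (hf : IsDensity f) {x z : ℝ}
    (hx : 0 < x) (hz : z ∈ superlevel f x) : |z - c| ≤ 1 / x := by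
  have key : ENNReal.ofReal (x * |z - c|) ≤ 1 := by
    rw [← hf.lintegral_eq_one, ENNReal.ofReal_mul hx.le]
    calc ENNReal.ofReal x * ENNReal.ofReal |z - c|
        = ∫⁻ _ in Icc c (c + |z - c|), ENNReal.ofReal x := by simp
      _ ≤ ∫⁻ y in Icc c (c + |z - c|), ENNReal.ofReal (f y) := by
          refine setLIntegral_mono' measurableSet_Icc fun y hy => ENNReal.ofReal_le_ofReal ?_
          refine le_trans hz (h.le_of_abs_le ?_)
          rw [abs_of_nonneg (by linarith [hy.1])]
          linarith [hy.2]
      _ ≤ _ := setLIntegral_le_lintegral _ _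
  rw [ENNReal.ofReal_le_one] at key
  rw [le_div_iff₀ hx]
  linarith

lemma bddAbove_superlevel (h : IsSymmUnimodalAt f c) (hf : IsDensity f) {x : ℝ} (hx : 0 < x) :
    BddAbove (superlevel f x) :=
  ⟨c + 1 / x, fun _ hz => by
    linarith [(abs_le.1 (h.abs_le_of_mem_superlevel hf hx hz)).2]⟩

lemma center_mem_superlevel (h : IsSymmUnimodalAt f c) {x : ℝ} (hx : x ≤ peak f) :
    c ∈ superlevel f x := by
  change x ≤ f c
  rwa [← h.peak_eq]

lemma bMinus_eq (h : IsSymmUnimodalAt f c) (hf : IsDensity f) {x : ℝ} (hx : 0 < x)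
    (hxp : x ≤ peak f) : bMinus f x = 2 * c - bPlus f x := by
  have hrefl : ∀ z, z ∈ superlevel f x → 2 * c - z ∈ superlevel f x := fun z hz =>
    le_trans hz (h.le_of_abs_le (by rw [abs_sub_comm z c]; ring_nf; rfl))
  have hb := h.bddAbove_superlevel hf hx
  have hne : (superlevel f x).Nonempty := ⟨c, h.center_mem_superlevel hxp⟩
  refine IsGLB.csInf_eq ⟨fun z hz => ?_, fun b hb' => ?_⟩ hne
  · have := le_csSup hb (hrefl z hz)
    rw [bPlus]; linarith
  · have : sSup (superlevel f x) ≤ 2 * c - b :=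
      csSup_le hne fun z hz => by linarith [hb' (hrefl z hz)]
    rw [bPlus]; linarith

lemma center_le_bPlus (h : IsSymmUnimodalAt f c) (hf : IsDensity f) {x : ℝ} (hx : 0 < x)
    (hxp : x ≤ peak f) : c ≤ bPlus f x :=
  le_csSup (h.bddAbove_superlevel hf hx) (h.center_mem_superlevel hxp)

lemma directDensity_eq (h : IsSymmUnimodalAt f c) (hf : IsDensity f) {x : ℝ}
    (hx : x ∈ Ioo 0 (peak f)) : directDensity f x = 2 * (bPlus f x - c) := by
  rw [directDensity, indicator_of_mem hx, h.bMinus_eq hf hx.1 hx.2.le]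
  ring

lemma directDensity_nonneg (h : IsSymmUnimodalAt f c) (hf : IsDensity f) (x : ℝ) :
    0 ≤ directDensity f x := by
  by_cases hx : x ∈ Ioo 0 (peak f)
  · rw [h.directDensity_eq hf hx]
    linarith [h.center_le_bPlus hf hx.1 hx.2.le]
  · rw [directDensity, indicator_of_notMem hx]

/-- The layer heights of the two quantizers are related by symmetrization in the height. -/
lemma shiftedDensity_eq (h : IsSymmUnimodalAt f c) (hf : IsDensity f) (x : ℝ) :
    shiftedDensity f x = (directDensity f x + directDensity f (peak f - x)) / 2 := by
  by_cases hx : x ∈ Ioo 0 (peak f)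
  · have hx' : peak f - x ∈ Ioo 0 (peak f) := ⟨by linarith [hx.2], by linarith [hx.1]⟩
    rw [h.directDensity_eq hf hx, h.directDensity_eq hf hx', shiftedDensity,
      indicator_of_mem hx, h.bMinus_eq hf hx'.1 hx'.2.le]
    ring
  · have hx' : peak f - x ∉ Ioo 0 (peak f) := fun h' => hx ⟨by linarith [h'.2], by linarith [h'.1]⟩
    rw [directDensity, shiftedDensity, indicator_of_notMem hx, indicator_of_notMem hx,
      indicator_of_notMem hx']
    simp

/-- Up to its endpoints, a superlevel set is the interval about `c` of length `directDensity f x`. -/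
lemma superlevel_ae_eq (h : IsSymmUnimodalAt f c) (hf : IsDensity f) {x : ℝ}
    (hx : x ∈ Ioo 0 (peak f)) :
    superlevel f x =ᵐ[volume] {z | |z - c| < directDensity f x / 2} := by
  rw [h.directDensity_eq hf hx]
  have hb := h.bddAbove_superlevel hf hx.1
  have hne : (superlevel f x).Nonempty := ⟨c, h.center_mem_superlevel hx.2.le⟩
  have hnull : ∀ᵐ z : ℝ, |z - c| ≠ bPlus f x - c := by
    have : {z : ℝ | ¬ |z - c| ≠ bPlus f x - c} ⊆ {bPlus f x, 2 * c - bPlus f x} := by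
      intro z hz
      simp only [ne_eq, not_not, mem_ofPred_eq] at hz
      rcases abs_cases (z - c) with ⟨e, _⟩ | ⟨e, _⟩
      · left; linarith
      · right; simp only [mem_singleton_iff]; linarith
    exact measure_mono_null this ((Set.toFinite _).measure_zero _)
  filter_upwards [hnull] with z hz
  refine propext ⟨fun hz' => ?_, fun hz' => ?_⟩
  · have hz1 : x ≤ f z := hz'
    have : c + |z - c| ∈ superlevel f x := by
      change x ≤ _
      rwa [← h.eq_abs]
    have := le_csSup hb this
    change |z - c| < _
    refine lt_of_le_of_ne ?_ (fun e => hz (by linarith))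
    change c + |z - c| ≤ bPlus f x at this
    linarith
  · change |z - c| < _ at hz'
    obtain ⟨w, hw, hw'⟩ := exists_lt_of_lt_csSup hne
      (show c + |z - c| < sSup (superlevel f x) by
        change _ < bPlus f x
        linarith)
    exact le_trans hw (h.le_of_abs_le (by linarith [le_abs_self (w - c)]))

lemma volume_real_superlevel (h : IsSymmUnimodalAt f c) (hf : IsDensity f) {x : ℝ}
    (hx : x ∈ Ioo 0 (peak f)) : volume.real (superlevel f x) = directDensity f x := by
  have e : {z | |z - c| < directDensity f x / 2}
      = Ioo (c - directDensity f x / 2) (c + directDensity f x / 2) := by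
    ext z; simp only [mem_ofPred_eq, abs_lt, mem_Ioo]
    constructor <;> rintro ⟨_, _⟩ <;> constructor <;> linarith
  rw [measureReal_congr (h.superlevel_ae_eq hf hx), e, Real.volume_real_Ioo_of_le]
  · ring
  · linarith [h.directDensity_nonneg hf x]

lemma measurable_directDensity (h : IsSymmUnimodalAt f c) (hf : IsDensity f) :
    Measurable (directDensity f) := by
  have e : directDensity f
      = (Ioo 0 (peak f)).indicator fun x => (volume (superlevel f x)).toReal := by
    ext x
    by_cases hx : x ∈ Ioo 0 (peak f)
    · rw [indicator_of_mem hx, ← h.volume_real_superlevel hf hx]; rfl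
    · rw [directDensity, indicator_of_notMem hx, indicator_of_notMem hx]
  rw [e]
  have hanti : Antitone fun x => volume (superlevel f x) := fun x y hxy =>
    measure_mono fun z (hz : y ≤ f z) => le_trans hxy hz
  exact hanti.measurable.ennreal_toReal.indicator measurableSet_Ioo

lemma measurable_shiftedDensity (h : IsSymmUnimodalAt f c) (hf : IsDensity f) :
    Measurable (shiftedDensity f) := by
  have := h.measurable_directDensity hf
  rw [funext (h.shiftedDensity_eq hf)]
  fun_prop

lemma shiftedDensity_nonneg (h : IsSymmUnimodalAt f c) (hf : IsDensity f) (x : ℝ) :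
    0 ≤ shiftedDensity f x := by
  rw [h.shiftedDensity_eq hf]
  linarith [h.directDensity_nonneg hf x, h.directDensity_nonneg hf (peak f - x)]

/-- Layer-cake formula: averaging a function `ρ` of the distance to the centre against `f` amounts
to integrating it over each layer of `f`, hence to integrating a primitive of `ρ` evaluated at the
half-width of the layer. -/
lemma layer_cake (h : IsSymmUnimodalAt f c) (hf : IsDensity f) {ρ : ℝ → ℝ} (hρ : Measurable ρ)
    (hint : Integrable fun z => f z * ρ |z - c|) :
    Integrable ((Ioo 0 (peak f)).indicator fun x =>
        2 * ∫ v in (0 : ℝ)..directDensity f x / 2, ρ v) ∧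
      ∫ z, f z * ρ |z - c| = ∫ x, (Ioo 0 (peak f)).indicator
        (fun x => 2 * ∫ v in (0 : ℝ)..directDensity f x / 2, ρ v) x := by
  set p := peak f with hp
  let F : ℝ → ℝ → ℝ := fun x z => if x ≤ f z then ρ |z - c| else 0
  have hFm : Measurable (Function.uncurry F) := by
    refine Measurable.ite (measurableSet_le measurable_fst (hf.measurable.comp measurable_snd)) ?_
      measurable_const
    fun_prop
  have hlen : ∀ z, (volume.restrict (Ioo 0 p)).real (Iic (f z)) = f z := by
    intro z
    have e : (Iic (f z) ∩ Ioo 0 p : Set ℝ) =ᵐ[volume] Ioc 0 (f z) := by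
      have hne : ∀ᵐ x : ℝ, x ≠ p := by simp [ae_iff]
      filter_upwards [hne] with x hx
      refine propext ⟨fun hx' => ⟨hx'.2.1, hx'.1⟩, fun hx' => ⟨hx'.2, hx'.1, ?_⟩⟩
      exact lt_of_le_of_ne (le_trans hx'.2 (h.le_peak z)) hx
    rw [measureReal_restrict_apply measurableSet_Iic, measureReal_congr e,
      Real.volume_real_Ioc_of_le (hf.nonneg z), sub_zero]
  have hin : ∀ z (C : ℝ), ∫ x in Ioo 0 p, (if x ≤ f z then C else 0) = f z * C := by
    intro z C
    have : (fun x => if x ≤ f z then C else 0) = (Iic (f z)).indicator fun _ => C := by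
      ext x; simp [indicator]
    rw [this, integral_indicator_const _ measurableSet_Iic, hlen, smul_eq_mul]
  have hFi : Integrable (Function.uncurry F) ((volume.restrict (Ioo 0 p)).prod volume) := by
    rw [integrable_prod_iff' hFm.aestronglyMeasurable]
    constructor
    · refine Filter.Eventually.of_forall fun z => ?_
      have : (fun x => Function.uncurry F (x, z)) = (Iic (f z)).indicator fun _ => ρ |z - c| := by
        ext x; simp [indicator, F, Function.uncurry]
      rw [this]
      exact (integrable_const _).indicator measurableSet_Iic
    · refine hint.norm.congr (Filter.Eventually.of_forall fun z => ?_)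
      have : (fun x => ‖Function.uncurry F (x, z)‖) = fun x => if x ≤ f z then |ρ (|z - c|)| else 0 := by
        ext x; simp only [F, Function.uncurry]; split_ifs <;> simp
      beta_reduce
      rw [this, hin, norm_mul, Real.norm_eq_abs, Real.norm_eq_abs, abs_of_nonneg (hf.nonneg z)]
  have hlay : ∀ x ∈ Ioo 0 p, ∫ z, F x z = 2 * ∫ v in (0 : ℝ)..directDensity f x / 2, ρ v := by
    intro x hx
    rw [← setIntegral_ball_eq ρ c (by linarith [h.directDensity_nonneg hf x]),
      ← integral_indicator (measurableSet_lt (by fun_prop) measurable_const)]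
    refine integral_congr_ae ?_
    filter_upwards [h.superlevel_ae_eq hf hx] with z hz
    have hz' : (x ≤ f z) = (|z - c| < directDensity f x / 2) := hz
    simp only [F, indicator, hz', mem_ofPred_eq]
  have hae : (fun x => ∫ z, F x z) =ᵐ[volume.restrict (Ioo 0 p)]
      fun x => 2 * ∫ v in (0 : ℝ)..directDensity f x / 2, ρ v := by
    filter_upwards [ae_restrict_mem measurableSet_Ioo] with x hx using hlay x hx
  constructor
  · rw [integrable_indicator_iff measurableSet_Ioo]
    exact hFi.integral_prod_left.congr hae
  · rw [integral_indicator measurableSet_Ioo, ← integral_congr_ae hae,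
      integral_integral_swap hFi]
    refine integral_congr_ae (Filter.Eventually.of_forall fun z => ?_)
    simp only [F, hin]

end IsSymmUnimodalAt

/-! ### Moments and entropy of the layer heights -/

lemma IsDensity.integrable {f : ℝ → ℝ} (hf : IsDensity f) : Integrable f := by
  refine ⟨hf.measurable.aestronglyMeasurable, ?_⟩
  rw [hasFiniteIntegral_iff_ofReal (Filter.Eventually.of_forall hf.nonneg), hf.lintegral_eq_one]
  exact ENNReal.one_lt_top

lemma IsDensity.integral_eq_one {f : ℝ → ℝ} (hf : IsDensity f) : ∫ x, f x = 1 := by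
  rw [integral_eq_lintegral_of_nonneg_ae (Filter.Eventually.of_forall hf.nonneg)
    hf.measurable.aestronglyMeasurable, hf.lintegral_eq_one, ENNReal.toReal_one]

/-- The derivative of `L ↦ L log₂ L` at `L = 2 v`, the length of an interval of half-width `v`. -/
def entropyTilt (v : ℝ) : ℝ := (Real.log (2 * v) + 1) / Real.log 2

lemma measurable_entropyTilt : Measurable entropyTilt := by
  unfold entropyTilt
  fun_prop

lemma integral_entropyTilt (L : ℝ) :
    2 * ∫ v in (0 : ℝ)..L / 2, entropyTilt v = L * Real.logb 2 L := by
  have hi : IntervalIntegrable (fun v => Real.log (2 * v)) volume 0 (L / 2) := by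
    have := (intervalIntegral.intervalIntegrable_log' (a := 0) (b := L)).comp_mul_left (c := 2)
    simpa using this
  have h1 : ∫ v in (0 : ℝ)..L / 2, Real.log (2 * v) = 2⁻¹ * (L * Real.log L - L) := by
    rw [intervalIntegral.integral_comp_mul_left (fun v => Real.log v) two_ne_zero, integral_log]
    simp only [smul_eq_mul]
    rw [show 2 * (L / 2) = L by ring]
    simp
  unfold entropyTilt
  rw [intervalIntegral.integral_div, intervalIntegral.integral_add hi (by simp), h1, Real.logb]
  simp only [intervalIntegral.integral_const, smul_eq_mul]
  ring

lemma integrable_indicator_log : Integrable ((Icc (-1 : ℝ) 1).indicator Real.log) := by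
  rw [integrable_indicator_iff measurableSet_Icc]
  have := (intervalIntegral.intervalIntegrable_log' (a := -1) (b := 1))
  rwa [intervalIntegrable_iff_integrableOn_Icc_of_le (by norm_num)] at this

namespace IsSymmUnimodalAt

variable {f : ℝ → ℝ} {c : ℝ}

/-- A bounded density with a first moment has a logarithmic moment. -/
lemma integrable_mul_entropyTilt (h : IsSymmUnimodalAt f c) (hf : IsDensity f)
    (hm : Integrable fun z => f z * |z - c|) :
    Integrable fun z => f z * entropyTilt |z - c| := by
  have hlog : Integrable fun z => (Icc (-1 : ℝ) 1).indicator Real.log (2 * (z - c)) :=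
    ((integrable_indicator_log).comp_mul_left' two_ne_zero).comp_sub_right c
  have hmain : Integrable fun z => f z * Real.log (2 * |z - c|) := by
    refine ((hm.const_mul 2).add (hlog.norm.const_mul (f c))).mono' ?_
      (Filter.Eventually.of_forall fun z => ?_)
    · have := hf.measurable
      exact Measurable.aestronglyMeasurable (by fun_prop)
    · have e : Real.log (2 * |z - c|) = Real.log (2 * (z - c)) := by
        rw [← Real.log_abs (2 * (z - c)), abs_mul, abs_two]
      have hz := hf.nonneg z
      have hzc := h.le_center z
      simp only [Pi.add_apply, norm_mul, Real.norm_eq_abs, abs_of_nonneg hz]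
      by_cases hI : 2 * (z - c) ∈ Icc (-1 : ℝ) 1
      · rw [indicator_of_mem hI, e]
        have h1 := mul_le_mul_of_nonneg_right hzc (abs_nonneg (Real.log (2 * (z - c))))
        have h2 := mul_nonneg hz (abs_nonneg (z - c))
        linarith
      · rw [indicator_of_notMem hI, abs_zero, mul_zero, add_zero]
        have h1 : 1 ≤ 2 * |z - c| := by
          rw [mem_Icc, ← abs_le, abs_mul, abs_two, not_le] at hI
          exact hI.le
        rw [abs_of_nonneg (Real.log_nonneg h1)]
        have h2 := Real.log_le_sub_one_of_pos (by linarith : 0 < 2 * |z - c|)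
        have := mul_le_mul_of_nonneg_left (h2.trans (sub_le_self _ zero_le_one)) hz
        linarith
  refine ((hmain.add hf.integrable).div_const (Real.log 2)).congr
    (Filter.Eventually.of_forall fun z => ?_)
  simp only [Pi.add_apply, entropyTilt]
  ring

lemma indicator_comp_directDensity (F : ℝ → ℝ) (hF : F 0 = 0) :
    ((Ioo 0 (peak f)).indicator fun x => F (directDensity f x))
      = fun x => F (directDensity f x) := by
  ext x
  by_cases hx : x ∈ Ioo 0 (peak f)
  · rw [indicator_of_mem hx]
  · rw [indicator_of_notMem hx, directDensity, indicator_of_notMem hx, hF]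

lemma integral_directDensity (h : IsSymmUnimodalAt f c) (hf : IsDensity f) :
    Integrable (directDensity f) ∧ ∫ x, directDensity f x = 1 := by
  have key := h.layer_cake hf (ρ := fun _ => 1) measurable_const (by simpa using hf.integrable)
  have e : ∀ L : ℝ, 2 * ∫ _ in (0 : ℝ)..L / 2, (1 : ℝ) = L := fun L => by
    simp only [intervalIntegral.integral_const, smul_eq_mul]; ring
  simp only [e, indicator_comp_directDensity (fun L => L) rfl, mul_one, hf.integral_eq_one] at key
  exact ⟨key.1, key.2.symm⟩

lemma integral_directDensity_sq (h : IsSymmUnimodalAt f c) (hf : IsDensity f)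
    (hm : Integrable fun z => f z * |z - c|) :
    (Integrable fun x => directDensity f x ^ 2) ∧
      ∫ x, directDensity f x ^ 2 = 4 * ∫ z, f z * |z - c| := by
  have key := h.layer_cake hf (ρ := fun v => v) measurable_id hm
  have e : ∀ L : ℝ, 2 * ∫ v in (0 : ℝ)..L / 2, v = 4⁻¹ * L ^ 2 := fun L => by
    rw [integral_id]; ring
  simp only [e, indicator_comp_directDensity (fun L => 4⁻¹ * L ^ 2) (by simp)] at key
  refine ⟨(key.1.const_mul 4).congr (Filter.Eventually.of_forall fun x => by simp), ?_⟩
  rw [key.2, integral_const_mul]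
  ring

lemma integral_directDensity_mul_logb (h : IsSymmUnimodalAt f c) (hf : IsDensity f)
    (hm : Integrable fun z => f z * |z - c|) :
    HasDiffEntropy (directDensity f) ∧
      diffEntropy (directDensity f) = -∫ z, f z * entropyTilt |z - c| := by
  have key := h.layer_cake hf measurable_entropyTilt (h.integrable_mul_entropyTilt hf hm)
  simp only [integral_entropyTilt,
    indicator_comp_directDensity (fun L => L * Real.logb 2 L) (by simp)] at key
  exact ⟨key.1, by rw [diffEntropy, key.2]⟩

lemma isDensity_shiftedDensity (h : IsSymmUnimodalAt f c) (hf : IsDensity f) :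
    IsDensity (shiftedDensity f) := by
  refine ⟨h.measurable_shiftedDensity hf, h.shiftedDensity_nonneg hf, ?_⟩
  obtain ⟨hi, h1⟩ := h.integral_directDensity hf
  have e := funext (h.shiftedDensity_eq hf)
  have hi' := hi.comp_sub_left (peak f)
  rw [← ofReal_integral_eq_lintegral_ofReal _ (Filter.Eventually.of_forall
    (h.shiftedDensity_nonneg hf)), e, integral_div, integral_add hi hi',
    integral_sub_left_eq_self (directDensity f), h1]
  · norm_num
  · rw [e]
    exact (hi.add hi').div_const 2

lemma integral_shiftedDensity_sq_le (h : IsSymmUnimodalAt f c) (hf : IsDensity f)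
    (hm : Integrable fun z => f z * |z - c|) :
    (Integrable fun x => shiftedDensity f x ^ 2) ∧
      ∫ x, shiftedDensity f x ^ 2 ≤ 4 * ∫ z, f z * |z - c| := by
  obtain ⟨hi, h1⟩ := h.integral_directDensity_sq hf hm
  have hi' : Integrable fun x => directDensity f (peak f - x) ^ 2 := hi.comp_sub_left (peak f)
  have hle : ∀ x, shiftedDensity f x ^ 2
      ≤ (directDensity f x ^ 2 + directDensity f (peak f - x) ^ 2) / 2 := fun x => by
    rw [h.shiftedDensity_eq hf]
    nlinarith [sq_nonneg (directDensity f x - directDensity f (peak f - x))]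
  have hi2 := (hi.add hi').div_const 2
  have hW : Integrable fun x => shiftedDensity f x ^ 2 :=
    hi2.mono' ((h.measurable_shiftedDensity hf).pow_const 2).aestronglyMeasurable
      (Filter.Eventually.of_forall fun x => by
        rw [Real.norm_eq_abs, abs_of_nonneg (sq_nonneg _)]
        exact hle x)
  refine ⟨hW, (integral_mono hW hi2 hle).trans_eq ?_⟩
  simp only [Pi.add_apply]
  rw [integral_div, integral_add hi hi',
    integral_sub_left_eq_self (fun x => directDensity f x ^ 2), h1]
  ring

/-- Concavity of `-L log₂ L` bounds the entropy integrand of `f_W` from below by the average of those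
of `f_D` and of its reflection; dropping one of the two summands inside the logarithm bounds it from
above by the same average plus a term that integrates to one bit. The statement concerns the negated
integrands. -/
lemma shiftedDensity_mul_logb_mem_Icc (h : IsSymmUnimodalAt f c) (hf : IsDensity f) (x : ℝ) :
    shiftedDensity f x * Real.logb 2 (shiftedDensity f x) ∈
      Icc ((directDensity f x * Real.logb 2 (directDensity f x)
          + directDensity f (peak f - x) * Real.logb 2 (directDensity f (peak f - x))) / 2
          - (directDensity f x + directDensity f (peak f - x)) / 2)
        ((directDensity f x * Real.logb 2 (directDensity f x)
          + directDensity f (peak f - x) * Real.logb 2 (directDensity f (peak f - x))) / 2) := by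
  rw [h.shiftedDensity_eq hf]
  have hA := h.directDensity_nonneg hf x
  have hB := h.directDensity_nonneg hf (peak f - x)
  generalize directDensity f x = A at *
  generalize directDensity f (peak f - x) = B at *
  have drop : ∀ a b : ℝ, 0 ≤ a → 0 ≤ b →
      a * Real.logb 2 a - a ≤ a * Real.logb 2 ((a + b) / 2) := fun a b ha hb => by
    rcases ha.eq_or_lt with rfl | ha
    · simp
    · have h1 : Real.logb 2 (a / 2) ≤ Real.logb 2 ((a + b) / 2) :=
        Real.logb_le_logb_of_le one_lt_two (by positivity) (by linarith)
      rw [Real.logb_div ha.ne' two_ne_zero, Real.logb_self_eq_one one_lt_two] at h1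
      nlinarith
  constructor
  · have h1 := drop A B hA hB
    have h2 := drop B A hB hA
    rw [add_comm B A] at h2
    linarith
  · have hc := Real.convexOn_mul_log.2 (mem_Ici.2 hA) (mem_Ici.2 hB)
      (by norm_num : (0 : ℝ) ≤ 1 / 2) (by norm_num : (0 : ℝ) ≤ 1 / 2) (by norm_num)
    simp only [smul_eq_mul] at hc
    have hl : (0 : ℝ) < Real.log 2 := Real.log_pos one_lt_two
    simp only [Real.logb, ← mul_div_assoc, ← add_div]
    rw [div_right_comm, div_le_div_iff_of_pos_right hl]
    rw [← mul_add, one_div, inv_mul_eq_div] at hc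
    linarith

lemma diffEntropy_shiftedDensity_le (h : IsSymmUnimodalAt f c) (hf : IsDensity f)
    (hm : Integrable fun z => f z * |z - c|) :
    HasDiffEntropy (shiftedDensity f) ∧
      diffEntropy (shiftedDensity f) ≤ diffEntropy (directDensity f) + 1 := by
  obtain ⟨hi, h1⟩ := h.integral_directDensity hf
  have hi' := hi.comp_sub_left (peak f)
  have hl : Integrable fun x => directDensity f x * Real.logb 2 (directDensity f x) :=
    (h.integral_directDensity_mul_logb hf hm).1
  have hl' : Integrable fun x =>
      directDensity f (peak f - x) * Real.logb 2 (directDensity f (peak f - x)) :=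
    hl.comp_sub_left (peak f)
  have hmeas := h.measurable_shiftedDensity hf
  have hup := (hl.add hl').div_const 2
  have hlow := hup.sub ((hi.add hi').div_const 2)
  have hW : HasDiffEntropy (shiftedDensity f) := by
    refine integrable_of_le_of_le
      (f := fun x => shiftedDensity f x * Real.logb 2 (shiftedDensity f x)) ?_
      (Filter.Eventually.of_forall fun x => (h.shiftedDensity_mul_logb_mem_Icc hf x).1)
      (Filter.Eventually.of_forall fun x => (h.shiftedDensity_mul_logb_mem_Icc hf x).2) hlow hup
    unfold Real.logb
    exact Measurable.aestronglyMeasurable (by fun_prop)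
  refine ⟨hW, ?_⟩
  have := integral_mono hlow hW fun x => (h.shiftedDensity_mul_logb_mem_Icc hf x).1
  rw [integral_sub' hup ((hi.add hi').div_const 2)] at this
  simp only [Pi.add_apply] at this
  rw [integral_div, integral_div, integral_add hi hi', integral_add hl hl',
    integral_sub_left_eq_self (directDensity f), h1,
    integral_sub_left_eq_self (fun x => directDensity f x * Real.logb 2 (directDensity f x))] at this
  simp only [diffEntropy]
  linarith

end IsSymmUnimodalAt

/-! ### Moments of the noise -/

lemma integrable_lawOf_iff {f : ℝ → ℝ} (hf : IsDensity f) {φ : ℝ → ℝ} :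
    Integrable φ (lawOf f) ↔ Integrable fun z => f z * φ z := by
  rw [lawOf, integrable_withDensity_iff hf.measurable.ennreal_ofReal (by simp)]
  refine integrable_congr (Filter.Eventually.of_forall fun z => ?_)
  simp only [ENNReal.toReal_ofReal (hf.nonneg z)]
  ring

lemma integral_lawOf {f : ℝ → ℝ} (hf : IsDensity f) (φ : ℝ → ℝ) :
    ∫ z, φ z ∂lawOf f = ∫ z, f z * φ z := by
  rw [lawOf, integral_withDensity_eq_integral_toReal_smul hf.measurable.ennreal_ofReal (by simp)]
  refine integral_congr_ae (Filter.Eventually.of_forall fun z => ?_)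
  simp only [ENNReal.toReal_ofReal (hf.nonneg z), smul_eq_mul]

/-- A symmetric density with a first moment has its centre of symmetry as mean, so that the mean
distance to the centre is at most the standard deviation. -/
lemma IsSymmUnimodalAt.integral_abs_le_sqrt_variance {Ω : Type*} [MeasurableSpace Ω]
    {P : Measure Ω} [IsProbabilityMeasure P] {f : ℝ → ℝ} {c : ℝ} (h : IsSymmUnimodalAt f c)
    (hf : IsDensity f) {Z : Ω → ℝ} (hZ : AEMeasurable Z P) (hlaw : P.map Z = lawOf f)
    (hvar : MemLp Z 2 P) :
    (Integrable fun z => f z * |z - c|) ∧ ∫ z, f z * |z - c| ≤ √(Var[Z; P]) := by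
  have hYm : MemLp (fun ω => Z ω - c) 2 P := hvar.sub (memLp_const c)
  have hYi : Integrable (fun ω => Z ω - c) P := hYm.integrable (by norm_num)
  have hcomp : ∀ φ : ℝ → ℝ, Measurable φ → Integrable (fun ω => φ (Z ω)) P →
      Integrable (fun z => f z * φ z) ∧ ∫ ω, φ (Z ω) ∂P = ∫ z, f z * φ z := fun φ hφ hi => by
    rw [← integrable_lawOf_iff hf, ← integral_lawOf hf, ← hlaw,
      integral_map hZ hφ.aestronglyMeasurable]
    exact ⟨(integrable_map_measure hφ.aestronglyMeasurable hZ).2 hi, rfl⟩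
  have hmean : ∫ ω, (Z ω - c) ∂P = 0 := by
    rw [(hcomp (fun z => z - c) (by fun_prop) hYi).2]
    have e : ∫ z, f z * (z - c) = -∫ z, f z * (z - c) := by
      nth_rewrite 1 [← integral_sub_left_eq_self (fun z => f z * (z - c)) volume (2 * c)]
      rw [← integral_neg]
      refine integral_congr_ae (Filter.Eventually.of_forall fun z => ?_)
      have hs := h.symm (c - z)
      simp only
      rw [show c + (c - z) = 2 * c - z by ring, show c - (c - z) = z by ring] at hs
      rw [hs]
      ring
    linarith
  obtain ⟨habs, habs'⟩ := hcomp (fun z => |z - c|) (by fun_prop) hYi.abs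
  refine ⟨habs, ?_⟩
  rw [← habs']
  have hv : Var[Z; P] = ∫ ω, (Z ω - c) ^ 2 ∂P := by
    rw [← variance_sub_const hvar.aestronglyMeasurable c, variance_eq_sub hYm, hmean]
    simp
  have hYa : MemLp (fun ω => |Z ω - c|) 2 P := hYm.abs
  have := variance_nonneg (fun ω => |Z ω - c|) P
  rw [variance_eq_sub hYa] at this
  simp only [Pi.pow_apply, sq_abs] at this
  refine Real.le_sqrt_of_sq_le ?_
  rw [hv]
  linarith

/-! ### Entropy of a law with finite support -/

/-- A law carried by `N` points has at most `log₂ N` bits of entropy; the bound stated here is the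
tangent to the logarithm at `L`, an affine function of `N`, so that it can be averaged over random
supports without appeal to Jensen's inequality. -/
lemma discreteEntropy_le {α : Type*} [MeasurableSpace α] [MeasurableSingletonClass α]
    (p : Measure α) [IsProbabilityMeasure p] (s : Finset α) (hs : ∀ᵐ m ∂p, m ∈ s) {L : ℝ}
    (hL : 0 < L) :
    discreteEntropy p ≤ ENNReal.ofReal (Real.logb 2 L + (s.card / L - 1) / Real.log 2) := by
  have hl : (0 : ℝ) < Real.log 2 := Real.log_pos one_lt_two
  have hout : ∀ m ∉ s, p.real {m} = 0 := fun m hm => by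
    have : p {m} = 0 := measure_mono_null (by simpa using hm) (ae_iff.1 hs)
    simp [measureReal_def, this]
  have hsum : ∑ m ∈ s, p.real {m} = 1 := by
    rw [sum_measureReal_singleton, measureReal_def,
      show p s = 1 from by rw [← prob_compl_eq_zero_iff s.measurableSet]; exact ae_iff.1 hs]
    simp
  have hterm : ∀ m, -(p.real {m} * Real.logb 2 (p.real {m}))
      ≤ p.real {m} * Real.logb 2 L + (1 / L - p.real {m}) / Real.log 2 := fun m => by
    rcases (measureReal_nonneg : 0 ≤ p.real {m}).eq_or_lt with h0 | h0
    · rw [← h0]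
      simp only [zero_mul, neg_zero, sub_zero, zero_add]
      positivity
    · generalize p.real {m} = q at h0
      have h1 := Real.log_le_sub_one_of_pos (show 0 < 1 / (q * L) by positivity)
      rw [one_div, Real.log_inv, Real.log_mul h0.ne' hL.ne'] at h1
      have h2 := mul_le_mul_of_nonneg_left h1 h0.le
      have h3 : q * ((q * L)⁻¹ - 1) = 1 / L - q := by field_simp
      rw [h3] at h2
      simp only [Real.logb]
      rw [← mul_div_assoc, ← mul_div_assoc, ← add_div, ← neg_div, div_le_div_iff_of_pos_right hl]
      linarith
  rw [discreteEntropy, tsum_eq_sum (s := s) (fun m hm => by simp [hout m hm]),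
    ← ENNReal.ofReal_sum_of_nonneg]
  · refine ENNReal.ofReal_le_ofReal ((Finset.sum_le_sum fun m _ => hterm m).trans_eq ?_)
    rw [Finset.sum_add_distrib, ← Finset.sum_mul, ← Finset.sum_div, Finset.sum_sub_distrib, hsum]
    simp only [Finset.sum_const, nsmul_eq_mul]
    ring
  · intro m _
    rw [neg_nonneg]
    exact mul_nonpos_of_nonneg_of_nonpos measureReal_nonneg
      (Real.logb_nonpos one_lt_two measureReal_nonneg measureReal_le_one)

/-! ### The entropy of the shifted layered quantizer -/

lemma discreteEntropy_map_floor_le {μ : Measure ℝ} [IsProbabilityMeasure μ] {a t : ℝ} (ht : 0 < t)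
    (hμ : ∀ᵐ x ∂μ, x ∈ Icc a (a + t)) {Δ : ℝ} (hΔ : 0 < Δ) (u : ℝ) {L : ℝ} (hL : 0 < L) :
    discreteEntropy (μ.map fun x => ⌊x / Δ + u + 1 / 2⌋) ≤ ENNReal.ofReal (Real.logb 2 L +
      (((⌊(a + t) / Δ + u + 1 / 2⌋ : ℝ) - ⌊a / Δ + u + 1 / 2⌋ + 1) / L - 1) / Real.log 2) := by
  have hmeas : Measurable fun x : ℝ => ⌊x / Δ + u + 1 / 2⌋ := by fun_prop
  have := Measure.isProbabilityMeasure_map (μ := μ) hmeas.aemeasurable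
  have hmono : Monotone fun x : ℝ => ⌊x / Δ + u + 1 / 2⌋ := fun x y hxy => by
    dsimp only
    gcongr
  have h1 := discreteEntropy_le (μ.map fun x => ⌊x / Δ + u + 1 / 2⌋)
    (Finset.Icc ⌊a / Δ + u + 1 / 2⌋ ⌊(a + t) / Δ + u + 1 / 2⌋) (by
      refine (ae_map_iff hmeas.aemeasurable (p := fun m => m ∈ Finset.Icc _ _)
        (Finset.measurableSet _)).2 ?_
      filter_upwards [hμ] with x hx
      exact Finset.mem_Icc.2 ⟨hmono hx.1, hmono hx.2⟩) hL
  have hcard : ((Finset.Icc ⌊a / Δ + u + 1 / 2⌋ ⌊(a + t) / Δ + u + 1 / 2⌋).card : ℝ)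
      = (⌊(a + t) / Δ + u + 1 / 2⌋ : ℝ) - ⌊a / Δ + u + 1 / 2⌋ + 1 := by
    have h2 : ⌊a / Δ + u + 1 / 2⌋ ≤ ⌊(a + t) / Δ + u + 1 / 2⌋ := hmono (by linarith : a ≤ a + t)
    have h3 := Int.card_Icc_of_le _ _ (h2.trans (Int.le_add_one le_rfl))
    have h4 := congrArg (fun n : ℤ => (n : ℝ)) h3
    push_cast at h4
    rw [h4]
    ring
  rwa [hcard] at h1

/-- A uniform dither makes the mean number of lattice points in an interval equal to its length. -/
lemma integral_floor_sub_floor (x y : ℝ) :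
    IntegrableOn (fun u : ℝ => (⌊y + u⌋ : ℝ) - ⌊x + u⌋) (Ioo 0 1) ∧
      ∫ u in Ioo (0 : ℝ) 1, ((⌊y + u⌋ : ℝ) - ⌊x + u⌋) = y - x := by
  have hfr : ∀ z : ℝ, IntegrableOn (fun u : ℝ => Int.fract (z + u)) (Ioo 0 1) := fun z =>
    Measure.integrableOn_of_bounded (M := 1) (by simp)
      (Measurable.aestronglyMeasurable (by fun_prop))
      (Filter.Eventually.of_forall fun u => by
        rw [Real.norm_eq_abs, abs_of_nonneg (Int.fract_nonneg _)]
        exact (Int.fract_lt_one _).le)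
  have hper : ∀ z : ℝ, ∫ u in Ioo (0 : ℝ) 1, Int.fract (z + u)
      = ∫ u in (0 : ℝ)..1, Int.fract u := fun z => by
    rw [← integral_Ioc_eq_integral_Ioo, ← intervalIntegral.integral_of_le zero_le_one,
      intervalIntegral.integral_comp_add_left (fun v => Int.fract v), add_zero]
    simpa using (Int.fract_periodic ℝ).intervalIntegral_add_eq z 0
  have e : (fun u : ℝ => (⌊y + u⌋ : ℝ) - ⌊x + u⌋)
      = fun u => (y - x) + (Int.fract (x + u) - Int.fract (y + u)) := by
    ext u
    simp only [Int.fract]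
    ring
  have hc : IntegrableOn (fun _ : ℝ => y - x) (Ioo 0 1) := integrableOn_const (by simp)
  rw [e]
  have hd : IntegrableOn (fun u : ℝ => Int.fract (x + u) - Int.fract (y + u)) (Ioo 0 1) :=
    (hfr x).sub (hfr y)
  refine ⟨hc.add hd, ?_⟩
  rw [integral_add hc hd, integral_sub (hfr x) (hfr y), hper, hper]
  simp

/-- Averaging the tangent bound on the entropy over the dither, with the tangent taken at the mean
number `1 + t / Δ` of descriptions. -/
lemma lintegral_entropy_bound (a : ℝ) {t Δ : ℝ} (ht : 0 < t) (hΔ : 0 < Δ) :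
    ∫⁻ u in Ioo (0 : ℝ) 1, ENNReal.ofReal (Real.logb 2 (1 + t / Δ) +
      (((⌊(a + t) / Δ + u + 1 / 2⌋ : ℝ) - ⌊a / Δ + u + 1 / 2⌋ + 1) / (1 + t / Δ) - 1) / Real.log 2)
      = ENNReal.ofReal (Real.logb 2 (1 + t / Δ)) := by
  have hl : (0 : ℝ) < Real.log 2 := Real.log_pos one_lt_two
  set L := 1 + t / Δ with hLdef
  have hL : 0 < L := by positivity
  obtain ⟨hi, hint⟩ := integral_floor_sub_floor (a / Δ + 1 / 2) ((a + t) / Δ + 1 / 2)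
  simp only [add_right_comm _ (1 / 2 : ℝ)] at hi hint
  have hc : ∀ C : ℝ, IntegrableOn (fun _ : ℝ => C) (Ioo 0 1) := fun C => integrableOn_const (by simp)
  have hi0 : IntegrableOn (fun u : ℝ =>
      ((⌊(a + t) / Δ + u + 1 / 2⌋ : ℝ) - ⌊a / Δ + u + 1 / 2⌋ + 1) / L) (Ioo 0 1) :=
    (hi.add (hc 1)).div_const L
  have hi1 : IntegrableOn (fun u : ℝ =>
      (((⌊(a + t) / Δ + u + 1 / 2⌋ : ℝ) - ⌊a / Δ + u + 1 / 2⌋ + 1) / L - 1) / Real.log 2)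
      (Ioo 0 1) := (hi0.sub (hc 1)).div_const (Real.log 2)
  have hi2 : IntegrableOn (fun u : ℝ => Real.logb 2 L +
      (((⌊(a + t) / Δ + u + 1 / 2⌋ : ℝ) - ⌊a / Δ + u + 1 / 2⌋ + 1) / L - 1) / Real.log 2)
      (Ioo 0 1) := (hc (Real.logb 2 L)).add hi1
  have hval : ∫ u in Ioo (0 : ℝ) 1, (Real.logb 2 L +
      (((⌊(a + t) / Δ + u + 1 / 2⌋ : ℝ) - ⌊a / Δ + u + 1 / 2⌋ + 1) / L - 1) / Real.log 2)
      = Real.logb 2 L := by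
    rw [integral_add (hc _) hi1, integral_div, integral_sub hi0 (hc 1), integral_div, integral_add hi (hc 1), hint]
    have e : ((a + t) / Δ + 1 / 2 - (a / Δ + 1 / 2) + 1) / L = 1 := by
      rw [div_eq_one_iff_eq hL.ne', hLdef]
      ring
    have hone : ∀ C : ℝ, ∫ _ in Ioo (0 : ℝ) 1, C = C := by simp
    simp only [hone, e, sub_self, zero_div, add_zero]
  rw [← ofReal_integral_eq_lintegral_ofReal hi2, hval]
  refine Filter.Eventually.of_forall fun u => ?_
  have hfl : (⌊a / Δ + u + 1 / 2⌋ : ℝ) ≤ ⌊(a + t) / Δ + u + 1 / 2⌋ := by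
    have : a ≤ a + t := by linarith
    exact_mod_cast Int.floor_le_floor (by gcongr)
  have h1 : 1 / L ≤ ((⌊(a + t) / Δ + u + 1 / 2⌋ : ℝ) - ⌊a / Δ + u + 1 / 2⌋ + 1) / L := by
    gcongr
    linarith
  have h2 := Real.one_sub_inv_le_log_of_pos hL
  rw [← one_div] at h2
  simp only [Pi.zero_apply, Real.logb, ← add_div]
  exact div_nonneg (by linarith) hl.le

lemma logb_one_add_div_le {t Δ : ℝ} (ht : 0 < t) (hΔ : 0 < Δ) :
    Real.logb 2 (1 + t / Δ) ≤ Real.logb 2 t - Real.logb 2 Δ + Δ / (t * Real.log 2) := by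
  have hl : (0 : ℝ) < Real.log 2 := Real.log_pos one_lt_two
  have e : 1 + t / Δ = t / Δ * (1 + Δ / t) := by field_simp; ring
  have h1 := Real.log_le_sub_one_of_pos (show 0 < 1 + Δ / t by positivity)
  rw [e, Real.logb_mul (by positivity) (by positivity), Real.logb_div ht.ne' hΔ.ne']
  have h2 : Real.logb 2 (1 + Δ / t) ≤ Δ / (t * Real.log 2) := by
    rw [Real.logb, ← div_div, div_le_div_iff_of_pos_right hl]
    linarith
  linarith

lemma IsSymmUnimodalAt.condEntropy_shiftedLayered_le {f : ℝ → ℝ} {c : ℝ}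
    (h : IsSymmUnimodalAt f c) (hf : IsDensity f) (hm : Integrable fun z => f z * |z - c|)
    {a t : ℝ} (ht : 0 < t) (μ : Measure ℝ) [IsProbabilityMeasure μ]
    (hμ : ∀ᵐ x ∂μ, x ∈ Icc a (a + t)) :
    (shiftedLayered f).condEntropy μ ≤ ENNReal.ofReal (Real.logb 2 t
        + diffEntropy (shiftedDensity f) + (∫ w, shiftedDensity f w ^ 2) / (t * Real.log 2)) ∧
      0 ≤ Real.logb 2 t + diffEntropy (shiftedDensity f)
        + (∫ w, shiftedDensity f w ^ 2) / (t * Real.log 2) := by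
  have hW := h.isDensity_shiftedDensity hf
  have hWm := hW.measurable
  have hent := (h.diffEntropy_shiftedDensity_le hf hm).1
  have hsq := (h.integral_shiftedDensity_sq_le hf hm).1
  have hlawm : Measurable fun w => ENNReal.ofReal (shiftedDensity f w) := hWm.ennreal_ofReal
  have : IsProbabilityMeasure (lawOf (shiftedDensity f)) :=
    ⟨by rw [lawOf, withDensity_apply _ .univ, Measure.restrict_univ, hW.lintegral_eq_one]⟩
  have hpos : ∀ᵐ w ∂lawOf (shiftedDensity f), 0 < shiftedDensity f w := by
    rw [lawOf, ae_withDensity_iff hlawm]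
    refine Filter.Eventually.of_forall fun w hw => ?_
    simpa using hw
  -- The integrand of the upper bound, weighted by the density of `W`.
  have hY : Integrable fun w => shiftedDensity f w * (Real.logb 2 t - Real.logb 2 (shiftedDensity f w)
      + shiftedDensity f w / (t * Real.log 2)) := by
    refine ((hW.integrable.mul_const (Real.logb 2 t)).sub hent |>.add
      (hsq.div_const (t * Real.log 2))).congr (Filter.Eventually.of_forall fun w => ?_)
    simp only [Pi.add_apply, Pi.sub_apply]
    ring
  have hYint : ∫ w, shiftedDensity f w * (Real.logb 2 t - Real.logb 2 (shiftedDensity f w)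
      + shiftedDensity f w / (t * Real.log 2)) = Real.logb 2 t + diffEntropy (shiftedDensity f)
        + (∫ w, shiftedDensity f w ^ 2) / (t * Real.log 2) := by
    rw [← integral_div]
    have e : ∀ w, shiftedDensity f w * (Real.logb 2 t - Real.logb 2 (shiftedDensity f w)
      + shiftedDensity f w / (t * Real.log 2)) = (shiftedDensity f w * Real.logb 2 t
        - shiftedDensity f w * Real.logb 2 (shiftedDensity f w))
        + shiftedDensity f w ^ 2 / (t * Real.log 2) := fun w => by ring
    simp only [e]
    have hi : Integrable fun w => shiftedDensity f w * Real.logb 2 t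
        - shiftedDensity f w * Real.logb 2 (shiftedDensity f w) :=
      (hW.integrable.mul_const (Real.logb 2 t)).sub hent
    rw [integral_add hi (hsq.div_const _), integral_sub (hW.integrable.mul_const (Real.logb 2 t)) hent,
      integral_mul_const, hW.integral_eq_one, diffEntropy]
    ring
  have hYnn : ∀ w, 0 ≤ shiftedDensity f w * (Real.logb 2 t - Real.logb 2 (shiftedDensity f w)
      + shiftedDensity f w / (t * Real.log 2)) := fun w => by
    rcases (hW.nonneg w).eq_or_lt with h0 | h0
    · rw [← h0, zero_mul]
    · have h1 : 0 ≤ t / shiftedDensity f w := by positivity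
      exact mul_nonneg h0.le ((Real.logb_nonneg one_lt_two (by linarith)).trans
        (logb_one_add_div_le ht h0))
  refine ⟨?_, hYint ▸ integral_nonneg hYnn⟩
  let G : ℝ × ℝ → ℝ≥0∞ := fun s => ENNReal.ofReal (Real.logb 2 (1 + t / shiftedDensity f s.2) +
      (((⌊(a + t) / shiftedDensity f s.2 + s.1 + 1 / 2⌋ : ℝ)
        - ⌊a / shiftedDensity f s.2 + s.1 + 1 / 2⌋ + 1) / (1 + t / shiftedDensity f s.2) - 1)
        / Real.log 2)
  have hG : Measurable G := by
    simp only [G, Real.logb]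
    fun_prop
  have hposprod : ∀ᵐ s ∂(shiftedLayered f).law, 0 < shiftedDensity f s.2 :=
    Measure.quasiMeasurePreserving_snd.ae hpos
  calc (shiftedLayered f).condEntropy μ ≤ ∫⁻ s, G s ∂(shiftedLayered f).law := by
        refine lintegral_mono_ae ?_
        filter_upwards [hposprod] with s hs
        exact discreteEntropy_map_floor_le ht hμ hs s.1 (by positivity)
    _ = ∫⁻ w, (∫⁻ u in Ioo (0 : ℝ) 1, G (u, w)) ∂lawOf (shiftedDensity f) := by
        rw [shiftedLayered, lintegral_prod_symm' _ hG]
    _ = ∫⁻ w, ENNReal.ofReal (Real.logb 2 (1 + t / shiftedDensity f w))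
          ∂lawOf (shiftedDensity f) := by
        refine lintegral_congr_ae ?_
        filter_upwards [hpos] with w hw
        exact lintegral_entropy_bound a ht hw
    _ = ∫⁻ w, ENNReal.ofReal (shiftedDensity f w)
          * ENNReal.ofReal (Real.logb 2 (1 + t / shiftedDensity f w)) := by
        rw [lawOf, lintegral_withDensity_eq_lintegral_mul _ hlawm]
        · rfl
        · unfold Real.logb
          fun_prop
    _ ≤ ∫⁻ w, ENNReal.ofReal (shiftedDensity f w * (Real.logb 2 t
          - Real.logb 2 (shiftedDensity f w) + shiftedDensity f w / (t * Real.log 2))) := by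
        refine lintegral_mono fun w => ?_
        rw [← ENNReal.ofReal_mul (hW.nonneg w)]
        refine ENNReal.ofReal_le_ofReal ?_
        rcases (hW.nonneg w).eq_or_lt with h0 | h0
        · rw [← h0, zero_mul, zero_mul]
        · exact mul_le_mul_of_nonneg_left (logb_one_add_div_le ht h0) h0.le
    _ = _ := by
        rw [← ofReal_integral_eq_lintegral_ofReal hY (Filter.Eventually.of_forall hYnn), hYint]

/-! ### The lower bound for arbitrary schemes -/

lemma intervalIntegrable_entropyTilt_abs (c a b : ℝ) :
    IntervalIntegrable (fun z => entropyTilt |z - c|) volume a b := by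
  have h1 : IntervalIntegrable (fun z => Real.log (2 * (z - c))) volume a b := by
    have := ((intervalIntegral.intervalIntegrable_log' (a := 2 * (a - c))
      (b := 2 * (b - c))).comp_mul_left (c := 2)).comp_sub_right c
    simpa using this
  have e : (fun z => entropyTilt |z - c|)
      = fun z => (Real.log (2 * (z - c)) + 1) / Real.log 2 := by
    ext z
    rw [entropyTilt, ← Real.log_abs (2 * (z - c)), abs_mul, abs_two]
  rw [e]
  exact (h1.add (intervalIntegrable_const (c := (1 : ℝ)))).div_const _

/-- Bathtub principle: among the sets of given length, the interval centred at `c` has the least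
integral of the increasing function `entropyTilt` of the distance to `c`. -/
lemma mul_logb_le_setIntegral_entropyTilt (c : ℝ) {B : Set ℝ} (hB : MeasurableSet B)
    (hfin : volume B ≠ ⊤) (hint : IntegrableOn (fun z => entropyTilt |z - c|) B) :
    volume.real B * Real.logb 2 (volume.real B) ≤ ∫ z in B, entropyTilt |z - c| := by
  set L := volume.real B with hL
  rcases (measureReal_nonneg : 0 ≤ volume.real B).eq_or_lt with h0 | h0
  · rw [← hL] at h0
    rw [← h0, zero_mul, Measure.restrict_eq_zero.2, integral_zero_measure]
    exact (measureReal_eq_zero_iff hfin).1 (hL ▸ h0.symm)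
  rw [← hL] at h0
  have hl : (0 : ℝ) < Real.log 2 := Real.log_pos one_lt_two
  set I := {z : ℝ | |z - c| < L / 2} with hI
  have hIeq : I = Ioo (c - L / 2) (c + L / 2) := by
    ext z; simp only [hI, mem_ofPred_eq, abs_lt, mem_Ioo]
    constructor <;> rintro ⟨_, _⟩ <;> constructor <;> linarith
  have hIm : MeasurableSet I := hIeq ▸ measurableSet_Ioo
  have hIvol : volume.real I = L := by
    rw [hIeq, Real.volume_real_Ioo_of_le (by linarith)]
    ring
  have hIint : IntegrableOn (fun z => entropyTilt |z - c|) I := by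
    rw [hIeq, ← intervalIntegrable_iff_integrableOn_Ioo_of_le (by linarith)]
    exact intervalIntegrable_entropyTilt_abs c _ _
  -- Subtracting the value on the boundary of the interval makes the integrand negative exactly
  -- inside the interval, so that replacing the interval by `B` cannot decrease the integral.
  set l := entropyTilt (L / 2) with hldef
  have hconst : ∀ {A : Set ℝ}, volume A ≠ ⊤ → IntegrableOn (fun _ : ℝ => l) A := fun hA =>
    integrableOn_const hA
  have hIfin : volume I ≠ ⊤ := by rw [hIeq]; simp
  have hle : (fun z => I.indicator (fun z => entropyTilt |z - c| - l) z)
      ≤ᵐ[volume] fun z => B.indicator (fun z => entropyTilt |z - c| - l) z := by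
    have hne : ∀ᵐ z : ℝ, z ≠ c := by simp [ae_iff]
    filter_upwards [hne] with z hz
    have hz' : 0 < |z - c| := abs_pos.2 (sub_ne_zero.2 hz)
    have hmono : ∀ {x y : ℝ}, 0 < x → x ≤ y → entropyTilt x ≤ entropyTilt y := fun hx hxy => by
      rw [entropyTilt, entropyTilt, div_le_div_iff_of_pos_right hl]
      have := Real.log_le_log (by linarith) (mul_le_mul_of_nonneg_left hxy zero_le_two)
      linarith
    by_cases hzI : z ∈ I
    · rw [indicator_of_mem hzI]
      have : entropyTilt |z - c| ≤ l := hmono hz' (le_of_lt hzI)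
      by_cases hzB : z ∈ B
      · rw [indicator_of_mem hzB]
      · rw [indicator_of_notMem hzB]; linarith
    · rw [indicator_of_notMem hzI]
      have : l ≤ entropyTilt |z - c| := hmono (by linarith) (not_lt.1 hzI)
      by_cases hzB : z ∈ B
      · rw [indicator_of_mem hzB]; linarith
      · rw [indicator_of_notMem hzB]
  have key := integral_mono_ae ((integrable_indicator_iff hIm).2 (hIint.sub (hconst hIfin)))
    ((integrable_indicator_iff hB).2 (hint.sub (hconst hfin))) hle
  rw [integral_indicator hIm, integral_indicator hB, integral_sub' hIint (hconst hIfin),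
    integral_sub' hint (hconst hfin), setIntegral_const, setIntegral_const, hIvol, ← hL,
    setIntegral_ball_eq _ _ (by linarith), integral_entropyTilt] at key
  linarith

lemma ofReal_le_tsum_ofReal {α : Type*} {q w : α → ℝ} {S : ℝ} (hq : HasSum q S)
    (hqw : ∀ m, q m ≤ w m) : ENNReal.ofReal S ≤ ∑' m, ENNReal.ofReal (w m) := by
  have hs : Summable fun m => max (q m) 0 :=
    hq.summable.abs.of_nonneg_of_le (fun m => le_max_right _ _)
      fun m => max_le (le_abs_self _) (abs_nonneg _)
  calc ENNReal.ofReal S ≤ ENNReal.ofReal (∑' m, max (q m) 0) :=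
        ENNReal.ofReal_le_ofReal (hasSum_le (fun m => le_max_left _ _) hq hs.hasSum)
    _ = ∑' m, ENNReal.ofReal (max (q m) 0) :=
        ENNReal.ofReal_tsum_of_nonneg (fun m => le_max_right _ _) hs
    _ ≤ _ := by
        refine ENNReal.tsum_le_tsum fun m => ?_
        rw [ENNReal.ofReal_max, ENNReal.ofReal_zero, max_eq_left zero_le]
        exact ENNReal.ofReal_le_ofReal (hqw m)

lemma ofReal_integral_le_lintegral_ofReal {α : Type*} [MeasurableSpace α] {μ : Measure α}
    {g : α → ℝ} (hg : Integrable g μ) :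
    ENNReal.ofReal (∫ x, g x ∂μ) ≤ ∫⁻ x, ENNReal.ofReal (g x) ∂μ := by
  calc ENNReal.ofReal (∫ x, g x ∂μ) ≤ ENNReal.ofReal (∫ x, max (g x) 0 ∂μ) :=
        ENNReal.ofReal_le_ofReal (integral_mono hg hg.pos_part fun x => le_max_left _ _)
    _ = ∫⁻ x, ENNReal.ofReal (max (g x) 0) ∂μ :=
        ofReal_integral_eq_lintegral_ofReal hg.pos_part
          (Filter.Eventually.of_forall fun x => le_max_right _ _)
    _ = _ := by simp [ENNReal.ofReal_max]

/-- Lower bound on the entropy of one quantizer (fixed shared randomness) with encoder `e` and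
reconstruction points `y`, in terms of its error: the bathtub principle is applied to each cell. -/
lemma ofReal_le_discreteEntropy_map {α : Type*} [MeasurableSpace α] [MeasurableSingletonClass α]
    [Countable α] {e : ℝ → α} (he : Measurable e) (y : α → ℝ) (c a : ℝ) {t : ℝ} (ht : 0 < t)
    (hint : Integrable (fun x => entropyTilt |y (e x) - x - c|) (uniformLaw a (a + t))) :
    ENNReal.ofReal (Real.logb 2 t - ∫ x, entropyTilt |y (e x) - x - c| ∂uniformLaw a (a + t))
      ≤ discreteEntropy ((uniformLaw a (a + t)).map e) := by
  have hvol : volume (Ioo a (a + t)) = ENNReal.ofReal t := by simp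
  have hprob : IsProbabilityMeasure (uniformLaw a (a + t)) :=
    cond_isProbabilityMeasure_of_finite (by rw [hvol]; simpa using ht) (by simp)
  have hcell : ∀ m, MeasurableSet (e ⁻¹' {m}) := fun m => he (measurableSet_singleton m)
  have hrestr : ∀ m, (uniformLaw a (a + t)).restrict (e ⁻¹' {m})
      = (ENNReal.ofReal t)⁻¹ • volume.restrict (e ⁻¹' {m} ∩ Ioo a (a + t)) := fun m => by
    rw [uniformLaw, ProbabilityTheory.cond, Measure.restrict_smul,
      Measure.restrict_restrict (hcell m), hvol]
  have hcoef : ((ENNReal.ofReal t)⁻¹).toReal = t⁻¹ := by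
    rw [ENNReal.toReal_inv, ENNReal.toReal_ofReal ht.le]
  have hp : ∀ m, ((uniformLaw a (a + t)).map e).real {m}
      = t⁻¹ * volume.real (e ⁻¹' {m} ∩ Ioo a (a + t)) := fun m => by
    have h1 : ((uniformLaw a (a + t)).map e).real {m}
        = ((uniformLaw a (a + t)).restrict (e ⁻¹' {m})).real univ := by
      rw [map_measureReal_apply he (measurableSet_singleton m), measureReal_restrict_apply_univ]
    rw [h1, hrestr, measureReal_ennreal_smul_apply, hcoef, measureReal_restrict_apply_univ]
  have hint' : Integrable (fun x => Real.logb 2 t - entropyTilt |y (e x) - x - c|)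
      (uniformLaw a (a + t)) := (integrable_const _).sub hint
  have hsum := hasSum_integral_iUnion (f := fun x => Real.logb 2 t - entropyTilt |y (e x) - x - c|)
    (μ := uniformLaw a (a + t)) hcell (fun m n hmn => (disjoint_singleton.2 hmn).preimage e)
    hint'.integrableOn
  rw [← preimage_iUnion, iUnion_of_singleton, preimage_univ, setIntegral_univ,
    integral_sub (integrable_const _) hint] at hsum
  simp only [integral_const, probReal_univ, one_smul] at hsum
  refine ofReal_le_tsum_ofReal hsum fun m => ?_
  set A := e ⁻¹' {m} ∩ Ioo a (a + t) with hA
  have hAm : MeasurableSet A := (hcell m).inter measurableSet_Ioo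
  have hAfin : volume A ≠ ⊤ := measure_ne_top_of_subset inter_subset_right (by simp)
  have hcongr : ∀ x ∈ e ⁻¹' {m},
      entropyTilt |y (e x) - x - c| = entropyTilt |x - (y m - c)| := fun x hx => by
    rw [show e x = m from hx, ← abs_neg]
    ring_nf
  have hcI : IntegrableOn (fun x => entropyTilt |x - (y m - c)|) A := by
    have h1 : IntegrableOn (fun x => entropyTilt |x - (y m - c)|) (e ⁻¹' {m})
        (uniformLaw a (a + t)) := hint.integrableOn.congr_fun hcongr (hcell m)
    rw [IntegrableOn, hrestr, integrable_smul_measure] at h1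
    · exact h1
    · simp
    · simpa using ht
  have hbath := mul_logb_le_setIntegral_entropyTilt (y m - c) hAm hAfin hcI
  rw [integral_sub (integrable_const _) hint.integrableOn, setIntegral_congr_fun (hcell m) hcongr,
    hrestr, integral_smul_measure, integral_smul_measure, hcoef, setIntegral_const, hp]
  simp only [smul_eq_mul]
  rw [← hA]
  generalize (∫ x in A, entropyTilt |x - (y m - c)|) = J at *
  rcases (measureReal_nonneg : 0 ≤ volume.real A).eq_or_lt with h0 | h0
  · rw [← h0] at hbath ⊢
    simp only [zero_mul, mul_zero, neg_zero, zero_sub, neg_nonpos] at hbath ⊢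
    positivity
  · rw [Real.logb_mul (by positivity) h0.ne', Real.logb_inv]
    have := mul_le_mul_of_nonneg_left hbath (inv_nonneg.2 ht.le)
    linarith

/-- Any scheme whose error has the density `f` costs at least `log t + h(D_Z)` bits: the lower bounds
for the individual quantizers average, by Fubini's theorem, to an expectation over the error, which
the layer-cake formula evaluates. -/
lemma IsSymmUnimodalAt.ofReal_le_condEntropy {f : ℝ → ℝ} {c : ℝ} (h : IsSymmUnimodalAt f c)
    (hf : IsDensity f) (hm : Integrable fun z => f z * |z - c|) {a t : ℝ} (ht : 0 < t)
    {σ : Type u} [MeasurableSpace σ] {α : Type v} [MeasurableSpace α] [MeasurableSingletonClass α]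
    [Countable α] (Q : Scheme σ α) (hQ : Q.IsAINQ (Icc a (a + t)) (lawOf f)) :
    ENNReal.ofReal (Real.logb 2 t + diffEntropy (directDensity f))
      ≤ Q.condEntropy (uniformLaw a (a + t)) := by
  have := hQ.isProbabilityMeasure_law
  have hprob : IsProbabilityMeasure (uniformLaw a (a + t)) :=
    cond_isProbabilityMeasure_of_finite (by simpa using ht) (by simp)
  set U := uniformLaw a (a + t) with hU
  have hUmem : ∀ᵐ x ∂U, x ∈ Icc a (a + t) := by
    filter_upwards [ae_cond_mem (μ := volume) (measurableSet_Ioo : MeasurableSet (Ioo a (a + t)))]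
      with x hx using Ioo_subset_Icc_self hx
  let E : ℝ × σ → ℝ := fun p => Q.dec (Q.enc p.1 p.2) p.2 - p.1
  have hE : Measurable E :=
    (hQ.measurable_dec.comp (hQ.measurable_enc.prodMk measurable_snd)).sub measurable_fst
  have hmap : (U.prod Q.law).map E = lawOf f := by
    ext s hs
    rw [Measure.map_apply hE hs, Measure.prod_apply (hE hs)]
    calc ∫⁻ x, Q.law (Prod.mk x ⁻¹' (E ⁻¹' s)) ∂U = ∫⁻ _, lawOf f s ∂U := by
          refine lintegral_congr_ae ?_
          filter_upwards [hUmem] with x hx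
          rw [← hQ.map_error x hx,
            Measure.map_apply (f := fun s => Q.dec (Q.enc x s) s - x)
              (hE.comp measurable_prodMk_left) hs]
          rfl
      _ = lawOf f s := by simp
  have hψ : Measurable fun z => entropyTilt |z - c| :=
    measurable_entropyTilt.comp (by fun_prop)
  have hi : Integrable (fun p => entropyTilt |E p - c|) (U.prod Q.law) := by
    refine (integrable_map_measure (μ := U.prod Q.law) (f := E)
      (g := fun z => entropyTilt |z - c|) hψ.aestronglyMeasurable hE.aemeasurable).1 ?_
    rw [hmap, integrable_lawOf_iff hf]
    exact h.integrable_mul_entropyTilt hf hm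
  have hval : ∫ s, ∫ x, entropyTilt |E (x, s) - c| ∂U ∂Q.law
      = -diffEntropy (directDensity f) := by
    rw [← integral_prod_symm _ hi, (h.integral_directDensity_mul_logb hf hm).2, neg_neg,
      ← integral_lawOf hf, ← hmap, integral_map hE.aemeasurable hψ.aestronglyMeasurable]
  have hg : Integrable (fun s => Real.logb 2 t - ∫ x, entropyTilt |E (x, s) - c| ∂U) Q.law :=
    (integrable_const _).sub hi.integral_prod_right
  calc ENNReal.ofReal (Real.logb 2 t + diffEntropy (directDensity f))
      = ENNReal.ofReal (∫ s, (Real.logb 2 t - ∫ x, entropyTilt |E (x, s) - c| ∂U) ∂Q.law) := by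
        rw [integral_sub (integrable_const _) hi.integral_prod_right, hval]
        simp
    _ ≤ ∫⁻ s, ENNReal.ofReal (Real.logb 2 t - ∫ x, entropyTilt |E (x, s) - c| ∂U) ∂Q.law :=
        ofReal_integral_le_lintegral_ofReal hg
    _ ≤ Q.condEntropy U := by
        refine lintegral_mono_ae ?_
        filter_upwards [hi.prod_left_ae] with s hs
        exact ofReal_le_discreteEntropy_map (hQ.measurable_enc.comp measurable_prodMk_right)
          (fun m => Q.dec m s) c a ht hs

end LayeredQuantizer

end

/-- Here `f` is the target noise density, `Z` a random variable with that density, `μ` the law of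
the input, `W_Z` has density `shiftedDensity f` and `D_Z` has density `directDensity f`. -/
theorem proposition1
    {Ω : Type*} [MeasurableSpace Ω] (P : Measure Ω) [IsProbabilityMeasure P]
    (f : ℝ → ℝ) (hf : LayeredQuantizer.IsDensity f)
    (hsymm : LayeredQuantizer.IsSymmetric f) (hunim : LayeredQuantizer.IsUnimodal f)
    (Z : Ω → ℝ) (hZ : AEMeasurable Z P) (hlaw : P.map Z = LayeredQuantizer.lawOf f)
    (hvar : MemLp Z 2 P)
    (a t : ℝ) (ht : 0 < t)
    (μ : Measure ℝ) [IsProbabilityMeasure μ] (hμ : ∀ᵐ x ∂μ, x ∈ Icc a (a + t)) :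
    -- the bound on the conditional entropy
    (LayeredQuantizer.HasDiffEntropy (LayeredQuantizer.shiftedDensity f) ∧
      (LayeredQuantizer.shiftedLayered f).condEntropy μ ≠ ⊤ ∧
      ((LayeredQuantizer.shiftedLayered f).condEntropy μ).toReal ≤
        Real.logb 2 t + 8 * Real.logb 2 (Real.exp 1) / t * √(Var[Z; P])
          + LayeredQuantizer.diffEntropy (LayeredQuantizer.shiftedDensity f)) ∧
    -- the gap to the optimal conditional entropy over all schemes with the same error law
    ((LayeredQuantizer.shiftedLayered f).condEntropy μ ≤
      LayeredQuantizer.optimalCondEntropy.{u, v} (LayeredQuantizer.lawOf f) a t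
        + ENNReal.ofReal (8 * Real.logb 2 (Real.exp 1) / t * √(Var[Z; P]) + 2)) ∧
    -- the gap to the universal lower bound `log t + h(D_Z)`
    (LayeredQuantizer.HasDiffEntropy (LayeredQuantizer.directDensity f) ∧
      ((LayeredQuantizer.shiftedLayered f).condEntropy μ).toReal ≤
        (Real.logb 2 t + LayeredQuantizer.diffEntropy (LayeredQuantizer.directDensity f))
          + (8 * Real.logb 2 (Real.exp 1) / t * √(Var[Z; P]) + 2)) := by
  obtain ⟨c, h⟩ := hunim.exists_isSymmUnimodalAt hsymm
  obtain ⟨hm, hmv⟩ := h.integral_abs_le_sqrt_variance hf hZ hlaw hvar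
  obtain ⟨hentW, hWD⟩ := h.diffEntropy_shiftedDensity_le hf hm
  obtain ⟨hentD, -⟩ := h.integral_directDensity_mul_logb hf hm
  obtain ⟨hup, hnn⟩ := h.condEntropy_shiftedLayered_le hf hm ht μ hμ
  have hsq := (h.integral_shiftedDensity_sq_le hf hm).2
  have hl : (0 : ℝ) < Real.log 2 := Real.log_pos one_lt_two
  have hK : (∫ w, LayeredQuantizer.shiftedDensity f w ^ 2) / (t * Real.log 2)
      ≤ 8 * Real.logb 2 (Real.exp 1) / t * √(Var[Z; P]) := by
    have e : 8 * Real.logb 2 (Real.exp 1) / t * √(Var[Z; P])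
        = (8 * √(Var[Z; P])) / (t * Real.log 2) := by
      rw [Real.logb, Real.log_exp]
      field_simp
    rw [e, div_le_div_iff_of_pos_right (by positivity)]
    linarith [Real.sqrt_nonneg (Var[Z; P])]
  have htop := ne_top_of_le_ne_top ENNReal.ofReal_ne_top hup
  have hreal : ((LayeredQuantizer.shiftedLayered f).condEntropy μ).toReal
      ≤ Real.logb 2 t + 8 * Real.logb 2 (Real.exp 1) / t * √(Var[Z; P])
        + LayeredQuantizer.diffEntropy (LayeredQuantizer.shiftedDensity f) := by
    have := ENNReal.toReal_mono ENNReal.ofReal_ne_top hup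
    rw [ENNReal.toReal_ofReal hnn] at this
    linarith
  have hgap : ((LayeredQuantizer.shiftedLayered f).condEntropy μ).toReal ≤
        (Real.logb 2 t + LayeredQuantizer.diffEntropy (LayeredQuantizer.directDensity f))
          + (8 * Real.logb 2 (Real.exp 1) / t * √(Var[Z; P]) + 2) := by
    linarith
  refine ⟨⟨hentW, htop, hreal⟩, ?_, hentD, hgap⟩
  rw [← ENNReal.ofReal_toReal htop]
  refine (ENNReal.ofReal_le_ofReal hgap).trans (ENNReal.ofReal_add_le.trans ?_)
  gcongr
  simp only [LayeredQuantizer.optimalCondEntropy, le_iInf_iff]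
  intro σ _ α _ _ _ Q hQ
  exact h.ofReal_le_condEntropy hf hm ht Q hQ
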